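/- Fix $\alpha>0$ and an integer $d\ge 0$. For a finite Borel measure $\nu$ on $\mathbb R^d$ with $\nu(\{0\})=0$ and $\int_{|x|\le 2}|x|^2\,\nu(dx)+\int_{|x|>2}(\log|x|)^\alpha\,\nu(dx)<\infty$, let $$M_\alpha(B)=\int_{\mathbb R^d}\int_0^1 1_B(ry)\,(-\log r)^{\alpha-1}r^{-1}\,dr\,\nu(dy),$$ and, for $b\in\mathbb R^d$, let $L^*_\alpha(\nu,b)$ denote the infinitely divisible distribution on $\mathbb R^d$ with Lévy measure $M_\alpha$ (which satisfies $M_\alpha(\{0\})=0$ and $\int(|x|\wedge 1)\,M_\alpha(dx)<\infty$), drift $b$ and no Gaussian part, i.e. the one with characteristic function $$z\mapsto \exp\Big(i\langle b,z\rangle+\int_{\mathbb R^d}\big(e^{i\langle z,x\rangle}-1\big)\,M_\alpha(dx)\Big).$$ **Theorem.** Let $X_1,X_2,\dots$ be iid random variables with values in $[0,1]$ and $P(X_1>x)=(1-x)^\alpha\ell(1-x)$ for $x\in[0,1]$, where $\ell$ is slowly varying at $0$ (that is, $\ell(xt)/\ell(x)\to1$ as $x\to0^+$ for every $t>0$) and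 is bounded away from $0$ and $\infty$ on every compact subset of $(0,1]$. Let $\nu_0$ be a probability distribution on $\mathbb R^d$ and let $T_1,T_2,\dots$ be iid with distribution $\nu_0$, independent of the sequence $(X_i)$, with $\mathrm E|T_1|^\gamma<\infty$ for some $\gamma\in(0,1)$. Let $N_n$ be a sequence of nonnegative integers with $N_n n^{-\alpha}\ell(1/n)\to c$ for some $c\in(0,\infty)$. Then $\nu(dx)=\alpha c\,1_{\{|x|>0\}}\,\nu_0(dx)$ satisfies the conditions above, and $$A_n=\sum_{i=1}^{N_n}T_iX_i^n$$ converges in distribution, as $n\to\infty$, to a random vector with distribution $L^*_\alpha(\nu,0)$. -/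

import Mathlib

open MeasureTheory ProbabilityTheory Filter Topology Set

/-- `ℓ` is slowly varying at `0`: `ℓ (x t) / ℓ x → 1` as `x → 0+`, for every `t > 0`. -/
def SlowlyVaryingAtZero (ℓ : ℝ → ℝ) : Prop :=
  ∀ t : ℝ, 0 < t → Tendsto (fun x : ℝ => ℓ (x * t) / ℓ x) (𝓝[>] 0) (𝓝 1)

/-- `ℓ` is bounded away from `0` and `∞` on the set `K`. -/
def BoundedAwayOn (ℓ : ℝ → ℝ) (K : Set ℝ) : Prop :=
  ∃ m M : ℝ, 0 < m ∧ ∀ x ∈ K, m ≤ ℓ x ∧ ℓ x ≤ M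

/-- The measure `(-log r)^(α-1) r⁻¹ dr` on the interval `(0, 1)`. -/
noncomputable def logPowerMeasure (α : ℝ) : Measure ℝ :=
  (volume.restrict (Ioo (0 : ℝ) 1)).withDensity
    (fun r => ENNReal.ofReal ((-Real.log r) ^ (α - 1) * r⁻¹))

instance instSFiniteLogPowerMeasure (α : ℝ) : SFinite (logPowerMeasure α) := by
  unfold logPowerMeasure; infer_instance

/-- The measure `M_α(B) = ∫ ∫_0^1 1_B(r y) (-log r)^(α-1) r⁻¹ dr ν(dy)` on `ℝ^d`. -/
noncomputable def mixedMeasure {d : ℕ} (α : ℝ) (ν : Measure (EuclideanSpace ℝ (Fin d))) :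
    Measure (EuclideanSpace ℝ (Fin d)) :=
  (ν.prod (logPowerMeasure α)).map (fun p => p.2 • p.1)

theorem mixedMeasure_apply {d : ℕ} (α : ℝ) (ν : Measure (EuclideanSpace ℝ (Fin d)))
    {B : Set (EuclideanSpace ℝ (Fin d))} (hB : MeasurableSet B) :
    mixedMeasure α ν B = ∫⁻ y, ∫⁻ r in Ioo (0 : ℝ) 1,
      B.indicator 1 (r • y) * ENNReal.ofReal ((-Real.log r) ^ (α - 1) * r⁻¹) ∂volume ∂ν := by
  have hf : Measurable
      (fun p : EuclideanSpace ℝ (Fin d) × ℝ => p.2 • p.1) := by fun_prop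
  rw [mixedMeasure, Measure.map_apply hf hB, Measure.prod_apply (hf hB)]
  refine lintegral_congr fun y => ?_
  have hy : Measurable (fun r : ℝ => r • y) := by fun_prop
  have hd : Measurable
      (fun r : ℝ => ENNReal.ofReal ((-Real.log r) ^ (α - 1) * r⁻¹)) := by fun_prop
  have hs : MeasurableSet ((fun r : ℝ => r • y) ⁻¹' B) := hy hB
  change logPowerMeasure α ((fun r : ℝ => r • y) ⁻¹' B) = _
  rw [logPowerMeasure, withDensity_apply _ hs, ← lintegral_indicator hs]
  refine lintegral_congr fun r => ?_
  by_cases h : r • y ∈ B <;> simp [Set.indicator, h]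

/-- `μ = ID₀(M, γ)`: `μ` is the infinitely divisible probability distribution of finite variation
with Lévy measure `M`, drift `γ` and no Gaussian part. -/
structure IsID₀ {d : ℕ} (M : Measure (EuclideanSpace ℝ (Fin d))) (γ : EuclideanSpace ℝ (Fin d))
    (μ : Measure (EuclideanSpace ℝ (Fin d))) : Prop where
  isProbabilityMeasure : IsProbabilityMeasure μ
  levy_zero : M {0} = 0
  levy_finite : ∫⁻ x, ENNReal.ofReal (min ‖x‖ 1) ∂M < ⊤
  charFun_eq : ∀ z : EuclideanSpace ℝ (Fin d),
    charFun μ z = Complex.exp (Complex.I * (inner ℝ γ z : ℝ) +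
      ∫ x, (Complex.exp (Complex.I * (inner ℝ z x : ℝ)) - 1) ∂M)

/-- `μ = L*_α(ν, γ)`: `ν` is a finite Borel measure on `ℝ^d` with `ν {0} = 0` and
`∫_{|x| ≤ 2} |x|^2 dν + ∫_{|x| > 2} (log |x|)^α dν < ∞`, and `μ = ID₀(M_α, γ)`, where `M_α` is
obtained from `ν`. -/
structure IsLStar {d : ℕ} (α : ℝ) (ν : Measure (EuclideanSpace ℝ (Fin d)))
    (γ : EuclideanSpace ℝ (Fin d)) (μ : Measure (EuclideanSpace ℝ (Fin d))) : Prop where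
  isFiniteMeasure : IsFiniteMeasure ν
  bdlm_zero : ν {0} = 0
  bdlm_finite : (∫⁻ x in {x | ‖x‖ ≤ 2}, ENNReal.ofReal (‖x‖ ^ 2) ∂ν) +
    (∫⁻ x in {x | 2 < ‖x‖}, ENNReal.ofReal ((Real.log ‖x‖) ^ α) ∂ν) < ⊤
  isID₀ : IsID₀ (mixedMeasure α ν) γ μ

/-! Put G(x) = P(X_1 > 1 - x), equal to x^α ℓ(x) on (0, 1]. It is monotone and regularly varying at
0 with index α, and the hypothesis on N_n says N_n G(1/n) → c. Let λ_n be N_n times the law of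
X_1^n. For 0 < r < 1 its tail beyond r is N_n G(1 - r^(1/n)), and 1 - r^(1/n) ~ (-log r)/n, so the
tails converge to c (-log r)^α, the tail of αc times `logPowerMeasure α`
(`tendsto_natCast_mul_one_sub_rpow_inv`, `logPowerMeasure_Ioi`).

By independence A_n has characteristic function (1 + g_n(z))^(N_n), where N_n g_n(z) = ∫∫
(e^{i⟨z,t⟩x} - 1) λ_n(dx) ν₀(dt). A layer-cake formula writes the inner integral as the tail of λ_n
integrated against a bounded function. A doubling argument bounds the tails by C r^(-γ/2) for all
large n (`exists_natCast_mul_one_sub_rpow_inv_le`), so the inner integrals converge by domination.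
The same bound controls the γ-moments of λ_n; with |e^{iu} - 1| ≤ 2|u|^γ and E|T_1|^γ < ∞ it carries
the limit through ν₀. The limiting exponent is continuous at 0, Lévy's continuity theorem gives the
limit law, and Fubini identifies its exponent. -/

/-! ### Monotone functions regularly varying at 0, and elementary growth bounds. -/

/-- A sequence of monotone functions converging pointwise on `(0, ∞)` to a function continuous at
`L > 0` converges along every sequence of arguments tending to `L`. -/
theorem tendsto_of_monotone_of_tendsto {F : ℕ → ℝ → ℝ} {f : ℝ → ℝ} (hF : ∀ n, Monotone (F n))
    (hlim : ∀ x, 0 < x → Tendsto (fun n => F n x) atTop (𝓝 (f x))) {L : ℝ} (hL : 0 < L)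
    (hf : ContinuousAt f L) {u : ℕ → ℝ} (hu : Tendsto u atTop (𝓝 L)) :
    Tendsto (fun n => F n (u n)) atTop (𝓝 (f L)) := by
  rw [tendsto_order]
  constructor
  · intro a ha
    have h1 : ∀ᶠ x in 𝓝[<] L, a < f x ∧ 0 < x := nhdsWithin_le_nhds
      ((hf.eventually (lt_mem_nhds ha)).and (lt_mem_nhds hL))
    -- A fixed point x slightly left of L: eventually `u n > x`, so monotonicity bounds `F n (u n)`
    -- below by `F n x`.
    obtain ⟨x, ⟨hx1, hx2⟩, hx3⟩ := (h1.and self_mem_nhdsWithin).exists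
    filter_upwards [(hlim x hx2).eventually (lt_mem_nhds hx1), hu.eventually (lt_mem_nhds hx3)]
      with n h h'
    exact h.trans_le (hF n h'.le)
  · intro b hb
    have h1 : ∀ᶠ x in 𝓝[>] L, f x < b := nhdsWithin_le_nhds (hf.eventually (gt_mem_nhds hb))
    obtain ⟨x, hx1, hx3⟩ := (h1.and self_mem_nhdsWithin).exists
    filter_upwards [(hlim x (hL.trans hx3)).eventually (gt_mem_nhds hx1),
      hu.eventually (gt_mem_nhds hx3)] with n h h'
    exact (hF n h'.le).trans_lt h

/-- A monotone function, regularly varying at `0` with positive index, vanishes at `0+`. -/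
theorem tendsto_zero_of_regularlyVarying {G : ℝ → ℝ} {α : ℝ} (hα : 0 < α) (hmono : Monotone G)
    (hreg : ∀ t, 0 < t → Tendsto (fun x => G (x * t) / G x) (𝓝[>] 0) (𝓝 (t ^ α))) :
    Tendsto G (𝓝[>] 0) (𝓝 0) := by
  have hl := hmono.tendsto_nhdsGT 0
  set p := sInf (G '' Ioi 0) with hp
  by_cases hp0 : p = 0
  · rwa [hp0] at hl
  exfalso
  have h2 : Tendsto (fun x : ℝ => x * 2) (𝓝[>] 0) (𝓝[>] 0) := by
    refine tendsto_nhdsWithin_iff.2 ⟨?_, ?_⟩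
    · have : Tendsto (fun x : ℝ => x * 2) (𝓝 0) (𝓝 (0 * 2)) := by
        exact (continuous_mul_const 2).tendsto 0
      rw [zero_mul] at this
      exact this.mono_left nhdsWithin_le_nhds
    · filter_upwards [self_mem_nhdsWithin] with x hx
      have : (0 : ℝ) < x := hx
      simp [this]
  -- A nonzero limit at 0+ would force G(2x)/G(x) → 1, whereas 2^α > 1.
  have h3 := (hl.comp h2).div hl hp0
  have h4 := tendsto_nhds_unique h3 (hreg 2 two_pos)
  rw [div_self hp0] at h4
  exact (Real.one_lt_rpow one_lt_two hα).ne h4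

/-- Doubling property of a monotone function regularly varying at `0`. -/
theorem exists_doubling_of_regularlyVarying {G : ℝ → ℝ} {α : ℝ} (hmono : Monotone G)
    (hpos : ∀ x, 0 < x → 0 < G x) (h1 : ∀ x, G x ≤ 1)
    (hreg : ∀ t, 0 < t → Tendsto (fun x => G (x * t) / G x) (𝓝[>] 0) (𝓝 (t ^ α))) :
    ∃ p : ℕ, ∀ x, 0 < x → G (2 * x) ≤ 2 ^ p * G x := by
  have h2 := (hreg 2 two_pos).eventually (gt_mem_nhds (lt_add_one ((2 : ℝ) ^ α)))
  obtain ⟨δ, hδ, hδ2⟩ := mem_nhdsGT_iff_exists_Ioo_subset.1 h2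
  have hδ : 0 < δ := hδ
  -- The first entry covers small x by regular variation; the second covers x ≥ δ/2, where G(2x) ≤ 1
  -- ≤ G(x)/G(δ/2).
  set K := max ((2 : ℝ) ^ α + 1) (G (δ / 2))⁻¹
  obtain ⟨p, hp⟩ := pow_unbounded_of_one_lt K (one_lt_two : (1 : ℝ) < 2)
  refine ⟨p, fun x hx => ?_⟩
  have hG := hpos x hx
  by_cases hxδ : x < δ / 2
  · have h3 : G (x * 2) / G x < 2 ^ α + 1 := hδ2 ⟨hx, by linarith⟩
    rw [div_lt_iff₀ hG, mul_comm x] at h3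
    refine h3.le.trans ?_
    gcongr
    exact (le_max_left _ _).trans hp.le
  · have h3 : G (δ / 2) ≤ G x := hmono (not_lt.1 hxδ)
    have h4 := hpos (δ / 2) (by positivity)
    calc G (2 * x) ≤ 1 := h1 _
      _ = (G (δ / 2))⁻¹ * G (δ / 2) := by field_simp
      _ ≤ 2 ^ p * G x := by
        gcongr
        exact (le_max_right _ _).trans hp.le

/-- A monotone doubling function grows at most polynomially. -/
theorem le_pow_mul_of_doubling {G : ℝ → ℝ} (hmono : Monotone G) (h0 : ∀ x, 0 ≤ G x) {p : ℕ}
    (hp : ∀ x, 0 < x → G (2 * x) ≤ 2 ^ p * G x) {l x : ℝ} (hl : 0 ≤ l) (hx : 0 < x) :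
    G (l * x) ≤ (2 * (1 + l)) ^ p * G x := by
  have hk : ∀ k : ℕ, G (2 ^ k * x) ≤ (2 ^ k) ^ p * G x := by
    intro k
    induction k with
    | zero => simp
    | succ k ih =>
      calc G (2 ^ (k + 1) * x) = G (2 * (2 ^ k * x)) := by ring_nf
        _ ≤ 2 ^ p * G (2 ^ k * x) := hp _ (by positivity)
        _ ≤ 2 ^ p * ((2 ^ k) ^ p * G x) := by gcongr
        _ = (2 ^ (k + 1)) ^ p * G x := by ring
  -- 2^k ≤ 1 + l < 2^(k+1): k + 1 doublings reach past l and cost at most the factor (2(1 + l))^p.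
  obtain ⟨k, hk1, hk2⟩ := exists_nat_pow_near (show (1 : ℝ) ≤ 1 + l by linarith) one_lt_two
  calc G (l * x) ≤ G (2 ^ (k + 1) * x) := by
        apply hmono; gcongr; linarith
    _ ≤ (2 ^ (k + 1)) ^ p * G x := hk _
    _ ≤ (2 * (1 + l)) ^ p * G x := by
        have := h0 x
        gcongr
        rw [pow_succ, mul_comm]; gcongr

/-- Exponentials dominate powers. -/
theorem exists_one_add_pow_le_exp (p : ℕ) {δ : ℝ} (hδ : 0 < δ) :
    ∃ C : ℝ, 0 < C ∧ ∀ L : ℝ, 0 ≤ L → (1 + L) ^ p ≤ C * Real.exp (δ * L) := by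
  -- ε ≤ 1 gives 1 + L ≤ ε⁻¹(1 + εL) ≤ ε⁻¹ e^{εL}, and pε ≤ δ keeps the p-th power below e^{δL}.
  set ε : ℝ := min δ 1 / (p + 1) with hε
  have hm : 0 < min δ 1 := lt_min hδ one_pos
  have hε0 : 0 < ε := by positivity
  have hε1 : ε ≤ 1 := by
    rw [hε, div_le_one (by positivity)]
    have := min_le_right δ 1
    have : (0 : ℝ) ≤ p := p.cast_nonneg
    linarith
  have hεp : p * ε ≤ δ := by
    have h1 : ε * (p + 1) = min δ 1 := by rw [hε]; field_simp
    have := min_le_left δ 1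
    nlinarith
  refine ⟨ε⁻¹ ^ p, by positivity, fun L hL => ?_⟩
  have h1 : 1 + L ≤ ε⁻¹ * Real.exp (ε * L) := by
    rw [inv_mul_eq_div, le_div_iff₀ hε0]
    have := Real.add_one_le_exp (ε * L)
    nlinarith
  calc (1 + L) ^ p ≤ (ε⁻¹ * Real.exp (ε * L)) ^ p := by gcongr
    _ = ε⁻¹ ^ p * Real.exp (p * ε * L) := by
        rw [mul_pow, ← Real.exp_nat_mul, mul_assoc]
    _ ≤ ε⁻¹ ^ p * Real.exp (δ * L) := by gcongr

theorem exists_one_add_neg_log_pow_le_rpow (p : ℕ) {δ : ℝ} (hδ : 0 < δ) :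
    ∃ C : ℝ, 0 < C ∧ ∀ r ∈ Ioo (0 : ℝ) 1, (1 + -Real.log r) ^ p ≤ C * r ^ (-δ) := by
  obtain ⟨C, hC, h⟩ := exists_one_add_pow_le_exp p hδ
  refine ⟨C, hC, fun r hr => (h _ ?_).trans_eq ?_⟩
  · exact neg_nonneg.2 (Real.log_nonpos hr.1.le hr.2.le)
  · rw [Real.rpow_def_of_pos hr.1]; ring_nf

theorem rpow_inv_natCast_eq_exp {r : ℝ} (hr : 0 < r) (n : ℕ) :
    r ^ (n : ℝ)⁻¹ = Real.exp (-(-Real.log r / n)) := by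
  rw [Real.rpow_def_of_pos hr]; congr 1; ring

theorem tendsto_inv_natCast_nhdsGT_zero : Tendsto (fun n : ℕ => (n : ℝ)⁻¹) atTop (𝓝[>] 0) :=
  tendsto_inv_atTop_nhdsGT_zero.comp tendsto_natCast_atTop_atTop

/-! ### Tails rescaled by `N n`. -/

section Normalization

variable {G : ℝ → ℝ} {α c : ℝ} {N : ℕ → ℕ}

theorem tendsto_natCast_mul_regularlyVarying_div (hpos : ∀ x, 0 < x → 0 < G x)
    (hreg : ∀ t, 0 < t → Tendsto (fun x => G (x * t) / G x) (𝓝[>] 0) (𝓝 (t ^ α)))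
    (hN : Tendsto (fun n : ℕ => N n * G (n : ℝ)⁻¹) atTop (𝓝 c)) {t : ℝ} (ht : 0 < t) :
    Tendsto (fun n : ℕ => N n * G ((n : ℝ)⁻¹ * t)) atTop (𝓝 (c * t ^ α)) := by
  refine (hN.mul ((hreg t ht).comp tendsto_inv_natCast_nhdsGT_zero)).congr' ?_
  filter_upwards [eventually_gt_atTop 0] with n hn
  have := (hpos (n : ℝ)⁻¹ (by positivity)).ne'
  simp only [Function.comp]
  generalize G (n : ℝ)⁻¹ = y at *
  field_simp

/-- Pointwise convergence of the normalized tails. -/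
theorem tendsto_natCast_mul_one_sub_rpow_inv (hmono : Monotone G)
    (hpos : ∀ x, 0 < x → 0 < G x)
    (hreg : ∀ t, 0 < t → Tendsto (fun x => G (x * t) / G x) (𝓝[>] 0) (𝓝 (t ^ α)))
    (hN : Tendsto (fun n : ℕ => N n * G (n : ℝ)⁻¹) atTop (𝓝 c)) {r : ℝ} (hr : r ∈ Ioo (0 : ℝ) 1) :
    Tendsto (fun n : ℕ => N n * G (1 - r ^ (n : ℝ)⁻¹)) atTop (𝓝 (c * (-Real.log r) ^ α)) := by
  have hL : 0 < -Real.log r := neg_pos.2 (Real.log_neg hr.1 hr.2)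
  -- This limit is minus the derivative of x ↦ r^x at 0.
  have hu : Tendsto (fun n : ℕ => (n : ℝ) * (1 - r ^ (n : ℝ)⁻¹)) atTop (𝓝 (-Real.log r)) := by
    have hd : HasDerivAt (fun x : ℝ => r ^ x) (Real.log r) 0 := by
      simpa using (Real.hasStrictDerivAt_const_rpow hr.1 0).hasDerivAt
    have h1 := (hd.tendsto_slope_zero_right.comp tendsto_inv_natCast_nhdsGT_zero).neg
    refine h1.congr fun n => ?_
    simp; ring
  refine (tendsto_of_monotone_of_tendsto (F := fun n x => N n * G ((n : ℝ)⁻¹ * x))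
    (f := fun t => c * t ^ α) ?_ ?_ hL ?_ hu).congr' ?_
  · intro n x y hxy
    dsimp only
    have : G ((n : ℝ)⁻¹ * x) ≤ G ((n : ℝ)⁻¹ * y) := hmono (by gcongr)
    gcongr
  · exact fun t ht => tendsto_natCast_mul_regularlyVarying_div hpos hreg hN ht
  · exact (Real.continuousAt_rpow_const _ _ (Or.inl hL.ne')).const_mul c
  · filter_upwards [eventually_gt_atTop 0] with n hn
    have : (n : ℝ) ≠ 0 := by positivity
    rw [inv_mul_cancel_left₀ this]

/-- Domination of the normalized tails by small negative powers. -/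
theorem exists_natCast_mul_one_sub_rpow_inv_le (hmono : Monotone G)
    (hpos : ∀ x, 0 < x → 0 < G x) (h0 : ∀ x, 0 ≤ G x) (h1 : ∀ x, G x ≤ 1)
    (hreg : ∀ t, 0 < t → Tendsto (fun x => G (x * t) / G x) (𝓝[>] 0) (𝓝 (t ^ α)))
    (hN : Tendsto (fun n : ℕ => N n * G (n : ℝ)⁻¹) atTop (𝓝 c)) {δ : ℝ} (hδ : 0 < δ) :
    ∃ C : ℝ, 0 < C ∧ ∀ᶠ n : ℕ in atTop, ∀ r ∈ Ioo (0 : ℝ) 1,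
      N n * G (1 - r ^ (n : ℝ)⁻¹) ≤ C * r ^ (-δ) := by
  obtain ⟨p, hp⟩ := exists_doubling_of_regularlyVarying hmono hpos h1 hreg
  obtain ⟨C, hC, hCr⟩ := exists_one_add_neg_log_pow_le_rpow p hδ
  refine ⟨(|c| + 1) * 2 ^ p * C, by positivity, ?_⟩
  filter_upwards [hN.eventually (gt_mem_nhds (show c < |c| + 1 by linarith [le_abs_self c])),
    eventually_gt_atTop 0] with n hn hn0 r hr
  have hL : 0 ≤ -Real.log r := neg_nonneg.2 (Real.log_nonpos hr.1.le hr.2.le)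
  -- 1 - e^{-u} ≤ u with u = (-log r)/n.
  have h2 : 1 - r ^ (n : ℝ)⁻¹ ≤ -Real.log r * (n : ℝ)⁻¹ := by
    rw [rpow_inv_natCast_eq_exp hr.1]
    have := Real.add_one_le_exp (-(-Real.log r / n))
    rw [← div_eq_mul_inv]; linarith
  have h3 := le_pow_mul_of_doubling hmono h0 hp hL (show (0 : ℝ) < (n : ℝ)⁻¹ by positivity)
  calc N n * G (1 - r ^ (n : ℝ)⁻¹)
      ≤ N n * ((2 * (1 + -Real.log r)) ^ p * G (n : ℝ)⁻¹) := by
        gcongr; exact (hmono h2).trans h3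
    _ = (N n * G (n : ℝ)⁻¹) * 2 ^ p * (1 + -Real.log r) ^ p := by rw [mul_pow]; ring
    _ ≤ (|c| + 1) * 2 ^ p * (C * r ^ (-δ)) := by
        gcongr; exact hCr r hr
    _ = _ := by ring

/-- The normalizing sequence tends to infinity. -/
theorem tendsto_atTop_of_tendsto_mul_regularlyVarying (hα : 0 < α) (hc : 0 < c)
    (hmono : Monotone G) (hpos : ∀ x, 0 < x → 0 < G x)
    (hreg : ∀ t, 0 < t → Tendsto (fun x => G (x * t) / G x) (𝓝[>] 0) (𝓝 (t ^ α)))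
    (hN : Tendsto (fun n : ℕ => N n * G (n : ℝ)⁻¹) atTop (𝓝 c)) : Tendsto N atTop atTop := by
  have hG : Tendsto (fun n : ℕ => G (n : ℝ)⁻¹) atTop (𝓝[>] 0) := by
    refine tendsto_nhdsWithin_iff.2 ⟨(tendsto_zero_of_regularlyVarying hα hmono hreg).comp
      tendsto_inv_natCast_nhdsGT_zero, ?_⟩
    filter_upwards [eventually_gt_atTop 0] with n hn
    exact hpos _ (by positivity)
  have h2 := hN.pos_mul_atTop hc (tendsto_inv_nhdsGT_zero.comp hG)
  rw [← tendsto_natCast_atTop_iff (R := ℝ)]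
  refine h2.congr' ?_
  filter_upwards [eventually_gt_atTop 0] with n hn
  have := (hpos (n : ℝ)⁻¹ (by positivity)).ne'
  simp only [Function.comp]
  generalize G (n : ℝ)⁻¹ = y at *
  field_simp

end Normalization

/-! ### Fourier integrals and moments on [0, 1] through tails. -/

/-- The left side is at most min(|u|, 2): use |u| ≤ |u|^γ when |u| ≤ 1 and 1 ≤ |u|^γ otherwise. This
trades the exponential for a moment of order γ, the only one available for `T`. -/
theorem norm_exp_I_mul_sub_one_le_rpow {γ : ℝ} (hγ : γ ∈ Ioc (0 : ℝ) 1) (u : ℝ) :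
    ‖Complex.exp (Complex.I * u) - 1‖ ≤ 2 * |u| ^ γ := by
  by_cases hu : |u| ≤ 1
  · have h1 : |u| ≤ |u| ^ γ := by
      simpa using Real.rpow_le_rpow_of_exponent_ge' (abs_nonneg u) hu hγ.1.le hγ.2
    have := Real.norm_exp_I_mul_ofReal_sub_one_le (x := u)
    rw [Real.norm_eq_abs] at this
    linarith [abs_nonneg u]
  · have h1 : 1 ≤ |u| ^ γ := Real.one_le_rpow (not_le.1 hu).le hγ.1.le
    have h2 := norm_sub_le (Complex.exp (Complex.I * u)) 1
    rw [Complex.norm_exp_I_mul_ofReal, norm_one] at h2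
    linarith

theorem integral_Ioo_exp_I_mul (s : ℝ) {x : ℝ} (hx : 0 ≤ x) :
    ∫ r in Ioo 0 x, Complex.I * s * Complex.exp (Complex.I * ((s * r : ℝ) : ℂ)) =
      Complex.exp (Complex.I * ((s * x : ℝ) : ℂ)) - 1 := by
  rw [← integral_Ioc_eq_integral_Ioo, ← intervalIntegral.integral_of_le hx]
  have hd : ∀ r ∈ uIcc 0 x, HasDerivAt (fun r : ℝ => Complex.exp (Complex.I * ((s * r : ℝ) : ℂ)))
      (Complex.I * s * Complex.exp (Complex.I * ((s * r : ℝ) : ℂ))) r := by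
    intro r _
    have h1 : HasDerivAt (fun r : ℝ => Complex.I * ((s * r : ℝ) : ℂ)) (Complex.I * s) r := by
      have h2 : HasDerivAt (fun r : ℝ => s * r) s r := by
        simpa using (hasDerivAt_id r).const_mul s
      exact h2.ofReal_comp.const_mul _
    rw [mul_comm]
    exact h1.cexp
  rw [intervalIntegral.integral_eq_sub_of_hasDerivAt hd]
  · simp
  · apply Continuous.intervalIntegrable
    fun_prop

/-- Layer cake representation of `∫ (e^{isx} - 1) dμ` for a measure on `[0, 1]`. -/
theorem integral_exp_I_mul_sub_one_eq_integral_measureReal_Ioi {μ : Measure ℝ} [SFinite μ]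
    (h01 : ∀ᵐ x ∂μ, x ∈ Icc (0 : ℝ) 1) (hint : Integrable (fun x => x) μ) (s : ℝ) :
    ∫ x, (Complex.exp (Complex.I * ((s * x : ℝ) : ℂ)) - 1) ∂μ =
      ∫ r in Ioo (0 : ℝ) 1,
        μ.real (Ioi r) • (Complex.I * s * Complex.exp (Complex.I * ((s * r : ℝ) : ℂ))) := by
  set e : ℝ → ℂ := fun r => Complex.I * s * Complex.exp (Complex.I * ((s * r : ℝ) : ℂ)) with he
  have hem : Measurable e := by fun_prop
  have hen : ∀ r, ‖e r‖ = |s| := by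
    intro r
    rw [he, norm_mul, norm_mul, Complex.norm_exp_I_mul_ofReal]; simp
  -- Integrating in r first gives e^{isx} - 1; integrating in x first gives the tail at r.
  set f : ℝ × ℝ → ℂ := {p : ℝ × ℝ | p.2 < p.1}.indicator (fun p => e p.2) with hf
  have hfm : Measurable f := (hem.comp measurable_snd).indicator
    (measurableSet_lt measurable_snd measurable_fst)
  have hx : ∀ x ∈ Icc (0 : ℝ) 1, ∀ F : ℝ → ℂ,
      ∫ r in Ioo (0 : ℝ) 1, (Iio x).indicator F r = ∫ r in Ioo 0 x, F r := by
    intro x hx F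
    rw [setIntegral_indicator measurableSet_Iio]
    congr 2
    ext r; simp only [mem_inter_iff, mem_Ioo, mem_Iio]
    constructor
    · rintro ⟨⟨h1, h2⟩, h3⟩; exact ⟨h1, h3⟩
    · rintro ⟨h1, h3⟩; exact ⟨⟨h1, h3.trans_le hx.2⟩, h3⟩
  have hfx : ∀ x r, f (x, r) = (Iio x).indicator e r := by
    intro x r; simp [hf, indicator]
  have hfr : ∀ r x, f (x, r) = (Ioi r).indicator (fun _ => e r) x := by
    intro r x; simp [hf, indicator]
  have hfi : Integrable f (μ.prod (volume.restrict (Ioo (0 : ℝ) 1))) := by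
    rw [integrable_prod_iff hfm.aestronglyMeasurable]
    constructor
    · refine Eventually.of_forall fun x => ?_
      refine Integrable.mono' (integrable_const |s|)
        (hfm.comp measurable_prodMk_left).aestronglyMeasurable (Eventually.of_forall fun r => ?_)
      rw [hfx]
      exact (norm_indicator_le_norm_self _ _).trans (hen r).le
    -- The integral of |f(x, ·)| is at most |s| x, so a first moment suffices even when the measure
    -- is infinite.
    · refine (hint.const_mul |s|).mono' ?_ ?_
      · exact hfm.norm.stronglyMeasurable.integral_prod_right.aestronglyMeasurable
      · filter_upwards [h01] with x hx
        rw [Real.norm_of_nonneg (integral_nonneg fun _ => norm_nonneg _)]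
        calc ∫ r in Ioo (0 : ℝ) 1, ‖f (x, r)‖
            = ∫ r in Ioo (0 : ℝ) 1, (Iio x).indicator (fun _ => |s|) r := by
              congr 1; ext r
              rw [hfx, norm_indicator_eq_indicator_norm]
              simp only [hen]
          _ = ∫ r in Ioo 0 1 ∩ Iio x, |s| := setIntegral_indicator measurableSet_Iio
          _ ≤ ∫ r in Ioo 0 x, |s| := by
              refine setIntegral_mono_set ?_ ?_ ?_
              · exact integrableOn_const (by simp)
              · exact Eventually.of_forall fun _ => abs_nonneg s
              · exact LE.le.eventuallyLE (fun r hr => ⟨hr.1.1, hr.2⟩ : Ioo 0 1 ∩ Iio x ⊆ Ioo 0 x)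
          _ = |s| * x := by simp [hx.1, mul_comm]
  calc ∫ x, (Complex.exp (Complex.I * ((s * x : ℝ) : ℂ)) - 1) ∂μ
      = ∫ x, (∫ r in Ioo (0 : ℝ) 1, f (x, r)) ∂μ := by
        apply integral_congr_ae
        filter_upwards [h01] with x hx'
        simp_rw [hfx]
        rw [hx x hx', integral_Ioo_exp_I_mul s hx'.1]
    _ = ∫ r in Ioo (0 : ℝ) 1, ∫ x, f (x, r) ∂μ := integral_integral_swap (f := fun x r => f (x, r)) hfi
    _ = _ := by
        congr 1; ext r
        simp_rw [hfr]
        rw [integral_indicator measurableSet_Ioi, setIntegral_const]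

/-- A bound on a fractional moment of a measure on `[0, 1]` in terms of its tail. -/
theorem lintegral_rpow_le_of_measure_Ioi_le {γ : ℝ} (hγ : 0 < γ) {C : ℝ} (hC : 0 ≤ C)
    {μ : Measure ℝ} (h01 : ∀ᵐ x ∂μ, x ∈ Icc (0 : ℝ) 1)
    (htail : ∀ r ∈ Ioo (0 : ℝ) 1, μ (Ioi r) ≤ ENNReal.ofReal (C * r ^ (-(γ / 2)))) :
    ∫⁻ x, ENNReal.ofReal (x ^ γ) ∂μ ≤ ENNReal.ofReal (2 * C) := by
  -- The tail bound times t^(γ-1) is C t^(γ/2-1), with integral 2C/γ; the layer-cake prefactor γ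
  -- then leaves 2C.
  have hi : IntegrableOn (fun t : ℝ => t ^ (γ / 2 - 1)) (Ioo 0 1) :=
    (intervalIntegral.integrableOn_Ioo_rpow_iff one_pos).2 (by linarith)
  have hv : ∫ t in Ioo (0 : ℝ) 1, t ^ (γ / 2 - 1) = 2 / γ := by
    rw [← integral_Ioc_eq_integral_Ioo, ← intervalIntegral.integral_of_le zero_le_one,
      integral_rpow (Or.inl (by linarith))]
    rw [Real.one_rpow, Real.zero_rpow (by linarith)]
    rw [sub_add_cancel, sub_zero, one_div_div]
  rw [lintegral_rpow_eq_lintegral_meas_lt_mul μ (h01.mono fun x hx => hx.1) aemeasurable_id' hγ]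
  have h1 : ∀ t ∈ Ici (1 : ℝ), μ {a | t < a} = 0 := by
    intro t ht
    refine measure_mono_null (fun a (ha : t < a) => ?_) (ae_iff.1 h01)
    exact fun h => absurd h.2 (not_le.2 (lt_of_le_of_lt ht ha))
  have h2 : ∫⁻ t in Ioi (0 : ℝ), μ {a | t < a} * ENNReal.ofReal (t ^ (γ - 1)) ≤
      ∫⁻ t in Ioo (0 : ℝ) 1, ENNReal.ofReal (C * t ^ (γ / 2 - 1)) := by
    rw [← lintegral_indicator measurableSet_Ioi, ← lintegral_indicator measurableSet_Ioo]
    refine lintegral_mono fun t => ?_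
    by_cases ht0 : 0 < t
    · by_cases ht1 : t < 1
      · rw [indicator_of_mem (show t ∈ Ioi 0 from ht0),
          indicator_of_mem (show t ∈ Ioo (0 : ℝ) 1 from ⟨ht0, ht1⟩)]
        calc μ {a | t < a} * ENNReal.ofReal (t ^ (γ - 1))
            ≤ ENNReal.ofReal (C * t ^ (-(γ / 2))) * ENNReal.ofReal (t ^ (γ - 1)) := by
              gcongr; exact htail t ⟨ht0, ht1⟩
          _ = ENNReal.ofReal (C * t ^ (γ / 2 - 1)) := by
              rw [← ENNReal.ofReal_mul (by positivity), mul_assoc, ← Real.rpow_add ht0]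
              congr 3; ring
      · rw [indicator_of_mem (show t ∈ Ioi 0 from ht0), h1 t (not_lt.1 ht1), zero_mul]
        exact zero_le
    · rw [indicator_of_notMem (show t ∉ Ioi 0 from ht0)]
      exact zero_le
  refine (mul_le_mul_right h2 _).trans_eq ?_
  rw [← ofReal_integral_eq_lintegral_ofReal (hi.const_mul C), integral_const_mul, hv,
    ← ENNReal.ofReal_mul hγ.le]
  · congr 1; field_simp
  · filter_upwards [ae_restrict_mem measurableSet_Ioo] with t ht
    have := ht.1
    positivity

/-! ### Tail and moments of `logPowerMeasure`. -/

section LogPower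

variable {α : ℝ}

theorem ae_mem_Ioo_logPowerMeasure (α : ℝ) : ∀ᵐ r ∂logPowerMeasure α, r ∈ Ioo (0 : ℝ) 1 :=
  (withDensity_absolutelyContinuous _ _).ae_le (ae_restrict_mem measurableSet_Ioo)

theorem logPowerMeasure_Ioi (hα : 0 < α) {r : ℝ} (hr : r ∈ Ioo (0 : ℝ) 1) :
    logPowerMeasure α (Ioi r) = ENNReal.ofReal ((-Real.log r) ^ α / α) := by
  set F : ℝ → ℝ := fun u => -((-Real.log u) ^ α / α) with hF
  have hcont : ContinuousOn F (Icc r 1) := by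
    refine ContinuousOn.neg (ContinuousOn.div_const (ContinuousOn.rpow_const ?_ ?_) _)
    · refine (Real.continuousOn_log.mono fun u hu => ?_).neg
      exact (hr.1.trans_le hu.1).ne'
    · exact fun _ _ => Or.inr hα.le
  have hderiv : ∀ u ∈ Ioo r 1, HasDerivAt F ((-Real.log u) ^ (α - 1) * u⁻¹) u := by
    intro u hu
    have hu0 : 0 < u := hr.1.trans hu.1
    have hL : 0 < -Real.log u := neg_pos.2 (Real.log_neg hu0 hu.2)
    have h1 := (((Real.hasDerivAt_log hu0.ne').neg.rpow_const (p := α)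
      (Or.inl hL.ne')).div_const α).neg
    refine h1.congr_deriv ?_
    rw [Pi.neg_apply]
    field_simp
  have hnn : ∀ u ∈ Ioo r 1, 0 ≤ (-Real.log u) ^ (α - 1) * u⁻¹ := by
    intro u hu
    have hu0 : 0 < u := hr.1.trans hu.1
    have hL : 0 < -Real.log u := neg_pos.2 (Real.log_neg hu0 hu.2)
    positivity
  -- For α < 1 the density blows up at 1; integrability comes from the sign of the derivative and
  -- continuity of F up to 1.
  have hint := intervalIntegral.integrableOn_deriv_of_nonneg hcont hderiv hnn
  have hval : ∫ u in Ioo r 1, (-Real.log u) ^ (α - 1) * u⁻¹ = (-Real.log r) ^ α / α := by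
    rw [← integral_Ioc_eq_integral_Ioo, ← intervalIntegral.integral_of_le hr.2.le,
      intervalIntegral.integral_eq_sub_of_hasDerivAt_of_le hr.2.le hcont hderiv
        ((intervalIntegrable_iff_integrableOn_Ioc_of_le hr.2.le).2 hint)]
    simp [hF, Real.zero_rpow hα.ne']
  rw [logPowerMeasure, withDensity_apply _ measurableSet_Ioi,
    Measure.restrict_restrict measurableSet_Ioi]
  have hs : Ioi r ∩ Ioo 0 1 = Ioo r 1 := by
    ext u; simp only [mem_inter_iff, mem_Ioi, mem_Ioo]
    exact ⟨fun h => ⟨h.1, h.2.2⟩, fun h => ⟨h.1, hr.1.trans h.1, h.2⟩⟩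
  rw [hs, ← hval, ofReal_integral_eq_lintegral_ofReal (hint.mono_set Ioo_subset_Ioc_self)]
  filter_upwards [ae_restrict_mem measurableSet_Ioo] with u hu using hnn u hu

theorem exists_logPowerMeasure_Ioi_le (hα : 0 < α) {δ : ℝ} (hδ : 0 < δ) :
    ∃ C : ℝ, 0 < C ∧ ∀ r ∈ Ioo (0 : ℝ) 1,
      logPowerMeasure α (Ioi r) ≤ ENNReal.ofReal (C * r ^ (-δ)) := by
  obtain ⟨p, hp⟩ := exists_nat_ge α
  obtain ⟨C, hC, h⟩ := exists_one_add_neg_log_pow_le_rpow p hδ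
  refine ⟨C / α, by positivity, fun r hr => ?_⟩
  rw [logPowerMeasure_Ioi hα hr]
  apply ENNReal.ofReal_le_ofReal
  have hL : 0 < -Real.log r := neg_pos.2 (Real.log_neg hr.1 hr.2)
  rw [div_mul_eq_mul_div]
  gcongr
  refine le_trans ?_ (h r hr)
  calc (-Real.log r) ^ α ≤ (1 + -Real.log r) ^ α := by gcongr; linarith
    _ ≤ (1 + -Real.log r) ^ (p : ℝ) := by gcongr; linarith
    _ = _ := Real.rpow_natCast _ _

theorem lintegral_rpow_logPowerMeasure_lt_top (hα : 0 < α) {γ : ℝ} (hγ : 0 < γ) :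
    ∫⁻ r, ENNReal.ofReal (r ^ γ) ∂logPowerMeasure α < ⊤ := by
  obtain ⟨C, hC, h⟩ := exists_logPowerMeasure_Ioi_le hα (half_pos hγ)
  exact (lintegral_rpow_le_of_measure_Ioi_le hγ hC.le
    ((ae_mem_Ioo_logPowerMeasure α).mono fun r hr => Ioo_subset_Icc_self hr) h).trans_lt
      ENNReal.ofReal_lt_top

end LogPower

/-! ### Factorization over independent pairs. -/

section Independence

variable {Ω E F : Type*} [MeasurableSpace Ω] [MeasurableSpace E] [MeasurableSpace F]
  {P : Measure Ω} [IsProbabilityMeasure P]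

/-- For iid sequences `T`, `X` independent of each other, the expectation of a product of functions
of the pairs `(T i, X i)` is a power. -/
theorem integral_prod_range_eq_pow {T : ℕ → Ω → E} {X : ℕ → Ω → F}
    (hTm : ∀ i, Measurable (T i)) (hXm : ∀ i, Measurable (X i))
    (hT : iIndepFun T P) (hX : iIndepFun X P)
    (hTX : IndepFun (fun ω i => T i ω) (fun ω i => X i ω) P)
    {μ : Measure E} {ν : Measure F} [IsProbabilityMeasure μ] [IsProbabilityMeasure ν]
    (hTμ : ∀ i, P.map (T i) = μ) (hXν : ∀ i, P.map (X i) = ν)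
    {g : E × F → ℂ} (hg : Measurable g) (N : ℕ) :
    ∫ ω, ∏ i ∈ Finset.range N, g (T i ω, X i ω) ∂P = (∫ p, g p ∂μ.prod ν) ^ N := by
  set T' : Ω → Fin N → E := fun ω i => T i ω
  set X' : Ω → Fin N → F := fun ω i => X i ω
  have hT'm : Measurable T' := measurable_pi_lambda _ fun i => hTm i
  have hX'm : Measurable X' := measurable_pi_lambda _ fun i => hXm i
  have hT' : P.map T' = Measure.pi fun _ => μ := by
    have h := (iIndepFun_iff_map_fun_eq_pi_map (f := fun (i : Fin N) => T i)
      fun i => (hTm i).aemeasurable).1 (hT.precomp Fin.val_injective)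
    simp_rw [hTμ] at h
    exact h
  have hX' : P.map X' = Measure.pi fun _ => ν := by
    have h := (iIndepFun_iff_map_fun_eq_pi_map (f := fun (i : Fin N) => X i)
      fun i => (hXm i).aemeasurable).1 (hX.precomp Fin.val_injective)
    simp_rw [hXν] at h
    exact h
  have hind : IndepFun T' X' P := by
    have h1 : Measurable fun (t : ℕ → E) (i : Fin N) => t i := by fun_prop
    have h2 : Measurable fun (t : ℕ → F) (i : Fin N) => t i := by fun_prop
    exact hTX.comp h1 h2
  have hjoint : P.map (fun ω => (T' ω, X' ω)) =
      (Measure.pi fun _ => μ).prod (Measure.pi fun _ => ν) := by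
    rw [(indepFun_iff_map_prod_eq_prod_map_map hT'm.aemeasurable hX'm.aemeasurable).1 hind,
      hT', hX']
  -- Regroups a pair of N-tuples as an N-tuple of pairs, turning the joint law into a power of μ ⊗
  -- ν.
  have hmp := measurePreserving_arrowProdEquivProdArrow E F (Fin N) (fun _ => μ) (fun _ => ν)
  have hGm : Measurable fun q : (Fin N → E) × (Fin N → F) => ∏ i, g (q.1 i, q.2 i) := by
    fun_prop
  calc ∫ ω, ∏ i ∈ Finset.range N, g (T i ω, X i ω) ∂P
      = ∫ ω, ∏ i : Fin N, g (T' ω i, X' ω i) ∂P := by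
        simp_rw [Finset.prod_range]; rfl
    _ = ∫ q, ∏ i, g (q.1 i, q.2 i) ∂P.map (fun ω => (T' ω, X' ω)) := by
        rw [integral_map (by fun_prop) hGm.aestronglyMeasurable]
    _ = ∫ q : Fin N → E × F, ∏ i, g (q i) ∂Measure.pi fun _ => μ.prod ν := by
        rw [hjoint, ← hmp.integral_comp' (fun q => ∏ i, g (q.1 i, q.2 i))]
        rfl
    _ = _ := by
        rw [integral_fintype_prod_eq_prod (fun _ : Fin N => g)]
        simp

end Independence

/-! ### Limit theorems for characteristic functions. -/

/-- Lévy's continuity theorem. -/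
theorem exists_probabilityMeasure_of_tendsto_charFun {E : Type*} [NormedAddCommGroup E]
    [InnerProductSpace ℝ E] [FiniteDimensional ℝ E] [MeasurableSpace E] [BorelSpace E]
    {μ : ℕ → ProbabilityMeasure E} {f : E → ℂ} (hf : ContinuousAt f 0)
    (h : ∀ t, Tendsto (fun n => charFun (μ n : Measure E) t) atTop (𝓝 (f t))) :
    ∃ μ₀ : ProbabilityMeasure E, Tendsto μ atTop (𝓝 μ₀) ∧
      ∀ t, charFun (μ₀ : Measure E) t = f t := by
  have htight := isTightMeasureSet_of_tendsto_charFun (μ := fun n => (μ n : Measure E)) hf h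
  have hcpt : IsCompact (closure (range μ)) := by
    apply isCompact_closure_of_isTightMeasureSet
    convert htight using 1
    ext x; simp
  -- A single subsequential limit shows that f is a characteristic function; convergence of the
  -- whole sequence then follows.
  obtain ⟨μ₀, -, φ, hφ, hlim⟩ := hcpt.isSeqCompact (fun n => subset_closure (mem_range_self n))
  have hchar : ∀ t, charFun (μ₀ : Measure E) t = f t := fun t =>
    tendsto_nhds_unique ((ProbabilityMeasure.tendsto_iff_tendsto_charFun.1 hlim) t)
      ((h t).comp hφ.tendsto_atTop)
  refine ⟨μ₀, ProbabilityMeasure.tendsto_iff_tendsto_charFun.2 fun t => ?_, hchar⟩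
  rw [hchar]; exact h t

theorem tendsto_one_add_pow_exp_of_tendsto_mul {N : ℕ → ℕ} (hN : Tendsto N atTop atTop)
    {g : ℕ → ℂ} {t : ℂ} (hg : Tendsto (fun n => N n * g n) atTop (𝓝 t)) :
    Tendsto (fun n => (1 + g n) ^ N n) atTop (𝓝 (Complex.exp t)) := by
  have hNinv : Tendsto (fun n => ((N n : ℂ))⁻¹) atTop (𝓝 0) :=
    (tendsto_inv_atTop_nhds_zero_nat (𝕜 := ℂ)).comp hN
  have hg0 : Tendsto g atTop (𝓝 0) := by
    have h := hg.mul hNinv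
    rw [mul_zero] at h
    refine h.congr' ?_
    filter_upwards [hN.eventually_gt_atTop 0] with n hn
    have : (N n : ℂ) ≠ 0 := by exact_mod_cast hn.ne'
    field_simp
  have hg1 : Tendsto (fun n => 1 + g n) atTop (𝓝 1) := by
    simpa using hg0.const_add 1
  have hlog := Complex.hasDerivAt_log (z := 1) (by simp)
  -- log(1 + g) equals g times the slope of log between 1 and 1 + g. The extended slope tends to 1
  -- and needs no assumption g ≠ 0.
  have hds := (continuousAt_dslope_same.2 hlog.differentiableAt).tendsto.comp hg1
  rw [dslope_same, hlog.deriv, inv_one] at hds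
  have h := ((Complex.continuous_exp.tendsto _).comp (hg.mul hds))
  rw [mul_one] at h
  refine h.congr' ?_
  filter_upwards [hg1.eventually_ne one_ne_zero] with n hn
  have h1 := sub_smul_dslope Complex.log 1 (1 + g n)
  rw [add_sub_cancel_left, Complex.log_one, sub_zero, smul_eq_mul] at h1
  simp only [Function.comp]
  rw [mul_assoc, h1, Complex.exp_nat_mul, Complex.exp_log hn]

/-- Convergence of `∫ (e^{isx} - 1) dμ` from convergence of tails. -/
theorem tendsto_integral_exp_I_mul_sub_one {μ : ℕ → Measure ℝ} [∀ n, SFinite (μ n)]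
    {μ₀ : Measure ℝ} [SFinite μ₀]
    (h01 : ∀ n, ∀ᵐ x ∂μ n, x ∈ Icc (0 : ℝ) 1) (h01' : ∀ᵐ x ∂μ₀, x ∈ Icc (0 : ℝ) 1)
    (hint : ∀ n, Integrable (fun x => x) (μ n)) (hint' : Integrable (fun x => x) μ₀)
    {C δ : ℝ} (hδ : δ < 1)
    (hdom : ∀ᶠ n in atTop, ∀ r ∈ Ioo (0 : ℝ) 1, (μ n).real (Ioi r) ≤ C * r ^ (-δ))
    (hlim : ∀ r ∈ Ioo (0 : ℝ) 1,
      Tendsto (fun n => (μ n).real (Ioi r)) atTop (𝓝 (μ₀.real (Ioi r)))) (s : ℝ) :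
    Tendsto (fun n => ∫ x, (Complex.exp (Complex.I * ((s * x : ℝ) : ℂ)) - 1) ∂μ n) atTop
      (𝓝 (∫ x, (Complex.exp (Complex.I * ((s * x : ℝ) : ℂ)) - 1) ∂μ₀)) := by
  rw [integral_exp_I_mul_sub_one_eq_integral_measureReal_Ioi h01' hint']
  simp_rw [fun n => integral_exp_I_mul_sub_one_eq_integral_measureReal_Ioi (h01 n) (hint n) s]
  refine tendsto_integral_filter_of_dominated_convergence (fun r => C * r ^ (-δ) * |s|) ?_ ?_ ?_ ?_
  · refine Eventually.of_forall fun n => ?_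
    have he : Continuous fun r : ℝ =>
        Complex.I * s * Complex.exp (Complex.I * ((s * r : ℝ) : ℂ)) := by fun_prop
    have hm : Measurable fun r => (μ n) (Ioi r) :=
      Antitone.measurable fun a b hab => measure_mono (Ioi_subset_Ioi hab)
    exact (hm.ennreal_toReal.smul he.measurable).aestronglyMeasurable
  · filter_upwards [hdom] with n hn
    filter_upwards [ae_restrict_mem measurableSet_Ioo] with r hr
    rw [norm_smul, norm_mul, norm_mul, Complex.norm_exp_I_mul_ofReal]
    simp only [Complex.norm_I, one_mul, mul_one, Complex.norm_real, Real.norm_eq_abs,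
      abs_of_nonneg measureReal_nonneg]
    gcongr
    exact hn r hr
  · exact (((intervalIntegral.integrableOn_Ioo_rpow_iff one_pos).2 (by linarith)).const_mul
      C).mul_const _
  · filter_upwards [ae_restrict_mem measurableSet_Ioo] with r hr
    exact (hlim r hr).smul_const _

/-! ### Integration over the law of `T` using fractional moments. -/

section Moments

variable {γ : ℝ}

theorem norm_integral_exp_I_mul_sub_one_le (hγ : γ ∈ Ioc (0 : ℝ) 1) {μ : Measure ℝ}
    (h01 : ∀ᵐ x ∂μ, x ∈ Icc (0 : ℝ) 1) {M : ℝ} (hM : 0 ≤ M)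
    (hμ : ∫⁻ x, ENNReal.ofReal (x ^ γ) ∂μ ≤ ENNReal.ofReal M) (s : ℝ) :
    ‖∫ x, (Complex.exp (Complex.I * ((s * x : ℝ) : ℂ)) - 1) ∂μ‖ ≤ 2 * |s| ^ γ * M := by
  refine (norm_integral_le_lintegral_norm _).trans (ENNReal.toReal_le_of_le_ofReal (by positivity) ?_)
  calc ∫⁻ x, ENNReal.ofReal ‖Complex.exp (Complex.I * ((s * x : ℝ) : ℂ)) - 1‖ ∂μ
      ≤ ∫⁻ x, ENNReal.ofReal (2 * |s| ^ γ) * ENNReal.ofReal (x ^ γ) ∂μ := by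
        refine lintegral_mono_ae ?_
        filter_upwards [h01] with x hx
        rw [← ENNReal.ofReal_mul (by positivity)]
        apply ENNReal.ofReal_le_ofReal
        refine (norm_exp_I_mul_sub_one_le_rpow hγ (s * x)).trans_eq ?_
        rw [abs_mul, abs_of_nonneg hx.1, Real.mul_rpow (abs_nonneg _) hx.1]; ring
    _ = ENNReal.ofReal (2 * |s| ^ γ) * ∫⁻ x, ENNReal.ofReal (x ^ γ) ∂μ := by
        rw [lintegral_const_mul]; fun_prop
    _ ≤ ENNReal.ofReal (2 * |s| ^ γ) * ENNReal.ofReal M := by gcongr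
    _ = ENNReal.ofReal (2 * |s| ^ γ * M) := by rw [← ENNReal.ofReal_mul (by positivity)]

theorem integrable_id_of_lintegral_rpow_lt_top (hγ : γ ∈ Ioc (0 : ℝ) 1) {μ : Measure ℝ}
    (h01 : ∀ᵐ x ∂μ, x ∈ Icc (0 : ℝ) 1) (hμ : ∫⁻ x, ENNReal.ofReal (x ^ γ) ∂μ < ⊤) :
    Integrable (fun x => x) μ := by
  refine ⟨by fun_prop, ?_⟩
  rw [hasFiniteIntegral_iff_norm]
  refine lt_of_le_of_lt (lintegral_mono_ae ?_) hμ
  filter_upwards [h01] with x hx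
  apply ENNReal.ofReal_le_ofReal
  rw [Real.norm_of_nonneg hx.1]
  simpa using Real.rpow_le_rpow_of_exponent_ge' hx.1 hx.2 hγ.1.le hγ.2

theorem abs_inner_rpow_le {E : Type*} [NormedAddCommGroup E] [InnerProductSpace ℝ E]
    (hγ : 0 ≤ γ) (z t : E) :
    |inner ℝ z t| ^ γ ≤ ‖z‖ ^ γ * ‖t‖ ^ γ := by
  rw [← Real.mul_rpow (norm_nonneg _) (norm_nonneg _)]
  exact Real.rpow_le_rpow (abs_nonneg _) (abs_real_inner_le_norm z t) hγ

/-- Supplies the continuity at 0 of the limiting exponent that Lévy's theorem requires; the integral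
is O(‖z‖^γ). -/
theorem tendsto_integral_integral_exp_inner_sub_one_zero {E : Type*} [NormedAddCommGroup E]
    [InnerProductSpace ℝ E] [MeasurableSpace E] (hγ : γ ∈ Ioc (0 : ℝ) 1)
    {ν : Measure E} (hν : Integrable (fun t => ‖t‖ ^ γ) ν) {μ₀ : Measure ℝ}
    (h01 : ∀ᵐ x ∂μ₀, x ∈ Icc (0 : ℝ) 1) (hμ : ∫⁻ x, ENNReal.ofReal (x ^ γ) ∂μ₀ < ⊤) :
    Tendsto
      (fun z : E =>
        ∫ t, ∫ x, (Complex.exp (Complex.I * ((inner ℝ z t * x : ℝ) : ℂ)) - 1) ∂μ₀ ∂ν) (𝓝 0)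
      (𝓝 0) := by
  set M := (∫⁻ x, ENNReal.ofReal (x ^ γ) ∂μ₀).toReal
  have hM : 0 ≤ M := ENNReal.toReal_nonneg
  have hMμ : ∫⁻ x, ENNReal.ofReal (x ^ γ) ∂μ₀ ≤ ENNReal.ofReal M := (ENNReal.ofReal_toReal hμ.ne).ge
  have hb : ∀ z : E, ‖∫ t, ∫ x, (Complex.exp (Complex.I * ((inner ℝ z t * x : ℝ) : ℂ)) - 1) ∂μ₀ ∂ν‖
      ≤ ‖z‖ ^ γ * (2 * M * ∫ t, ‖t‖ ^ γ ∂ν) := by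
    intro z
    refine (norm_integral_le_of_norm_le (hν.const_mul (2 * ‖z‖ ^ γ * M))
      (Eventually.of_forall fun t => ?_)).trans_eq ?_
    · refine (norm_integral_exp_I_mul_sub_one_le hγ h01 hM hMμ _).trans ?_
      have := abs_inner_rpow_le hγ.1.le z t
      calc 2 * |inner ℝ z t| ^ γ * M ≤ 2 * (‖z‖ ^ γ * ‖t‖ ^ γ) * M := by gcongr
        _ = _ := by ring
    · rw [integral_const_mul]; ring
  refine squeeze_zero_norm hb ?_
  have h1 : Tendsto (fun z : E => ‖z‖ ^ γ) (𝓝 0) (𝓝 0) := by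
    have := (continuous_norm (E := E)).rpow_const (p := γ) (fun _ => Or.inr hγ.1.le)
    simpa [Real.zero_rpow hγ.1.ne'] using this.tendsto 0
  simpa using h1.mul_const (2 * M * ∫ t, ‖t‖ ^ γ ∂ν)

variable {E : Type*} [NormedAddCommGroup E] [InnerProductSpace ℝ E] [MeasurableSpace E]
  [BorelSpace E]

theorem stronglyMeasurable_integral_exp_inner_sub_one (μ : Measure ℝ) [SFinite μ] (z : E) :
    StronglyMeasurable fun t : E =>
      ∫ x, (Complex.exp (Complex.I * ((inner ℝ z t * x : ℝ) : ℂ)) - 1) ∂μ := by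
  have hc : Continuous fun p : E × ℝ =>
      Complex.exp (Complex.I * ((inner ℝ z p.1 * p.2 : ℝ) : ℂ)) - 1 := by fun_prop
  exact hc.measurable.stronglyMeasurable.integral_prod_right

/-- Passage to the limit under an integral with respect to a law having a fractional moment. -/
theorem tendsto_integral_integral_exp_inner_sub_one (hγ : γ ∈ Ioc (0 : ℝ) 1)
    {ν : Measure E} (hν : Integrable (fun t => ‖t‖ ^ γ) ν)
    {μ : ℕ → Measure ℝ} [∀ n, SFinite (μ n)] {μ₀ : Measure ℝ}
    (h01 : ∀ n, ∀ᵐ x ∂μ n, x ∈ Icc (0 : ℝ) 1) {M : ℝ} (hM : 0 ≤ M)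
    (hμ : ∀ᶠ n in atTop, ∫⁻ x, ENNReal.ofReal (x ^ γ) ∂μ n ≤ ENNReal.ofReal M)
    (hlim : ∀ s : ℝ, Tendsto
      (fun n => ∫ x, (Complex.exp (Complex.I * ((s * x : ℝ) : ℂ)) - 1) ∂μ n) atTop
      (𝓝 (∫ x, (Complex.exp (Complex.I * ((s * x : ℝ) : ℂ)) - 1) ∂μ₀))) (z : E) :
    Tendsto
      (fun n => ∫ t, ∫ x, (Complex.exp (Complex.I * ((inner ℝ z t * x : ℝ) : ℂ)) - 1) ∂μ n ∂ν) atTop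
      (𝓝 (∫ t, ∫ x, (Complex.exp (Complex.I * ((inner ℝ z t * x : ℝ) : ℂ)) - 1) ∂μ₀ ∂ν)) := by
  refine tendsto_integral_filter_of_dominated_convergence
    (fun t => 2 * ‖z‖ ^ γ * M * ‖t‖ ^ γ) ?_ ?_ (hν.const_mul _) ?_
  · exact Eventually.of_forall fun n =>
      (stronglyMeasurable_integral_exp_inner_sub_one (μ n) z).aestronglyMeasurable
  · filter_upwards [hμ] with n hn
    refine Eventually.of_forall fun t => ?_
    refine (norm_integral_exp_I_mul_sub_one_le hγ (h01 n) hM hn _).trans ?_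
    have := abs_inner_rpow_le hγ.1.le z t
    calc 2 * |inner ℝ z t| ^ γ * M ≤ 2 * (‖z‖ ^ γ * ‖t‖ ^ γ) * M := by gcongr
      _ = _ := by ring
  · exact Eventually.of_forall fun t => hlim _

end Moments

/-! ### Admissibility of `mixedMeasure` as a Lévy measure, and its exponent. -/

section Mixed

variable {d : ℕ} {α γ : ℝ} {ν : Measure (EuclideanSpace ℝ (Fin d))}

theorem mixedMeasure_singleton_zero [SFinite ν] (hν : ν {0} = 0) : mixedMeasure α ν {0} = 0 := by
  have hf : Measurable (fun p : EuclideanSpace ℝ (Fin d) × ℝ => p.2 • p.1) := by fun_prop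
  rw [mixedMeasure, Measure.map_apply hf (measurableSet_singleton 0)]
  have h1 : (ν.prod (logPowerMeasure α)) ({0} ×ˢ univ) = 0 := by
    rw [Measure.prod_prod, hν, zero_mul]
  have h2 : (ν.prod (logPowerMeasure α)) (univ ×ˢ (Ioo 0 1)ᶜ) = 0 := by
    rw [Measure.prod_prod, show logPowerMeasure α (Ioo 0 1)ᶜ = 0 from ae_mem_Ioo_logPowerMeasure α,
      mul_zero]
  refine measure_mono_null ?_ (measure_union_null h1 h2)
  rintro ⟨y, r⟩ h
  have h : r • y = 0 := h
  rcases smul_eq_zero.1 h with h | h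
  · exact Or.inr ⟨mem_univ _, fun hr => hr.1.ne' h⟩
  · exact Or.inl ⟨h, mem_univ _⟩

theorem lintegral_norm_rpow_mixedMeasure_lt_top (hα : 0 < α) (hγ : 0 < γ) [SFinite ν]
    (hν : ∫⁻ x, ENNReal.ofReal (‖x‖ ^ γ) ∂ν < ⊤) :
    ∫⁻ x, ENNReal.ofReal (‖x‖ ^ γ) ∂mixedMeasure α ν < ⊤ := by
  have hf : Measurable (fun p : EuclideanSpace ℝ (Fin d) × ℝ => p.2 • p.1) := by fun_prop
  rw [mixedMeasure, lintegral_map (by fun_prop) hf]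
  have h1 : ∀ p : EuclideanSpace ℝ (Fin d) × ℝ, ENNReal.ofReal (‖p.2 • p.1‖ ^ γ) =
      ENNReal.ofReal (‖p.1‖ ^ γ) * ENNReal.ofReal (|p.2| ^ γ) := by
    intro p
    rw [norm_smul, Real.mul_rpow (norm_nonneg _) (norm_nonneg _), ENNReal.ofReal_mul (by positivity),
      mul_comm, Real.norm_eq_abs]
  simp_rw [h1]
  rw [lintegral_prod_mul (f := fun y : EuclideanSpace ℝ (Fin d) => ENNReal.ofReal (‖y‖ ^ γ))
    (g := fun r : ℝ => ENNReal.ofReal (|r| ^ γ)) (by fun_prop) (by fun_prop)]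
  refine ENNReal.mul_lt_top hν ?_
  refine lt_of_le_of_lt (lintegral_mono_ae ?_) (lintegral_rpow_logPowerMeasure_lt_top hα hγ)
  filter_upwards [ae_mem_Ioo_logPowerMeasure α] with r hr
  rw [abs_of_pos hr.1]

theorem lintegral_min_mixedMeasure_lt_top (hα : 0 < α) (hγ : γ ∈ Ioc (0 : ℝ) 1) [SFinite ν]
    (hν : ∫⁻ x, ENNReal.ofReal (‖x‖ ^ γ) ∂ν < ⊤) :
    ∫⁻ x, ENNReal.ofReal (min ‖x‖ 1) ∂mixedMeasure α ν < ⊤ := by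
  refine lt_of_le_of_lt (lintegral_mono fun x => ?_)
    (lintegral_norm_rpow_mixedMeasure_lt_top hα hγ.1 hν)
  apply ENNReal.ofReal_le_ofReal
  by_cases h : ‖x‖ ≤ 1
  · refine (min_le_left _ _).trans ?_
    simpa using Real.rpow_le_rpow_of_exponent_ge' (norm_nonneg x) h hγ.1.le hγ.2
  · exact (min_le_right _ _).trans (Real.one_le_rpow (not_le.1 h).le hγ.1.le)

theorem integral_mixedMeasure_exp_sub_one (hα : 0 < α) (hγ : γ ∈ Ioc (0 : ℝ) 1) [SFinite ν]
    (hν : ∫⁻ x, ENNReal.ofReal (‖x‖ ^ γ) ∂ν < ⊤) (z : EuclideanSpace ℝ (Fin d)) :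
    ∫ x, (Complex.exp (Complex.I * (inner ℝ z x : ℝ)) - 1) ∂mixedMeasure α ν =
      ∫ y, ∫ r, (Complex.exp (Complex.I * ((inner ℝ z y * r : ℝ) : ℂ)) - 1)
        ∂logPowerMeasure α ∂ν := by
  have hf : Measurable (fun p : EuclideanSpace ℝ (Fin d) × ℝ => p.2 • p.1) := by fun_prop
  have hc : Continuous fun x : EuclideanSpace ℝ (Fin d) =>
      Complex.exp (Complex.I * (inner ℝ z x : ℝ)) - 1 := by fun_prop
  have hi : Integrable (fun x : EuclideanSpace ℝ (Fin d) =>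
      Complex.exp (Complex.I * (inner ℝ z x : ℝ)) - 1) (mixedMeasure α ν) := by
    have h1 : Integrable (fun x : EuclideanSpace ℝ (Fin d) => ‖x‖ ^ γ) (mixedMeasure α ν) := by
      refine ⟨(measurable_norm.pow_const γ).aestronglyMeasurable, ?_⟩
      rw [hasFiniteIntegral_iff_ofReal (Eventually.of_forall fun x => by positivity)]
      exact lintegral_norm_rpow_mixedMeasure_lt_top hα hγ.1 hν
    refine (h1.const_mul (2 * ‖z‖ ^ γ)).mono' hc.aestronglyMeasurable
      (Eventually.of_forall fun x => ?_)
    refine (norm_exp_I_mul_sub_one_le_rpow hγ _).trans ?_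
    have := abs_inner_rpow_le hγ.1.le z x
    linarith
  rw [mixedMeasure, integral_map hf.aemeasurable hc.aestronglyMeasurable, integral_prod]
  · simp_rw [inner_smul_right, mul_comm]
  · exact (integrable_map_measure hc.aestronglyMeasurable hf.aemeasurable).1 hi

theorem lintegral_log_rpow_lt_top (hα : 0 < α) (hγ : 0 < γ)
    (hν : ∫⁻ x, ENNReal.ofReal (‖x‖ ^ γ) ∂ν < ⊤) :
    ∫⁻ x in {x | 2 < ‖x‖}, ENNReal.ofReal ((Real.log ‖x‖) ^ α) ∂ν < ⊤ := by
  -- The exponent in log t ≤ t^ε/ε is ε = γ/α, so that the α-th power is a multiple of t^γ.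
  have hε : 0 < γ / α := by positivity
  have hb : ∀ x : EuclideanSpace ℝ (Fin d), 2 < ‖x‖ → ENNReal.ofReal ((Real.log ‖x‖) ^ α) ≤
      ENNReal.ofReal (((γ / α) ^ α)⁻¹) * ENNReal.ofReal (‖x‖ ^ γ) := by
    intro x hx
    rw [← ENNReal.ofReal_mul (by positivity)]
    apply ENNReal.ofReal_le_ofReal
    have h1 : 0 ≤ Real.log ‖x‖ := Real.log_nonneg (by linarith)
    calc (Real.log ‖x‖) ^ α ≤ (‖x‖ ^ (γ / α) / (γ / α)) ^ α :=
          Real.rpow_le_rpow h1 (Real.log_le_rpow_div (norm_nonneg _) hε) hα.le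
      _ = ((γ / α) ^ α)⁻¹ * ‖x‖ ^ γ := by
          rw [Real.div_rpow (by positivity) hε.le, ← Real.rpow_mul (norm_nonneg _),
            div_mul_cancel₀ _ hα.ne', div_eq_inv_mul]
  calc ∫⁻ x in {x | 2 < ‖x‖}, ENNReal.ofReal ((Real.log ‖x‖) ^ α) ∂ν
      ≤ ∫⁻ x in {x | 2 < ‖x‖},
          ENNReal.ofReal (((γ / α) ^ α)⁻¹) * ENNReal.ofReal (‖x‖ ^ γ) ∂ν :=
        setLIntegral_mono (by fun_prop) hb
    _ ≤ ∫⁻ x, ENNReal.ofReal (((γ / α) ^ α)⁻¹) * ENNReal.ofReal (‖x‖ ^ γ) ∂ν :=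
        setLIntegral_le_lintegral _ _
    _ = ENNReal.ofReal (((γ / α) ^ α)⁻¹) * ∫⁻ x, ENNReal.ofReal (‖x‖ ^ γ) ∂ν := by
        rw [lintegral_const_mul]; fun_prop
    _ < ⊤ := ENNReal.mul_lt_top ENNReal.ofReal_lt_top hν

theorem lintegral_norm_sq_lt_top [IsFiniteMeasure ν] :
    ∫⁻ x in {x | ‖x‖ ≤ 2}, ENNReal.ofReal (‖x‖ ^ 2) ∂ν < ⊤ := by
  calc ∫⁻ x in {x | ‖x‖ ≤ 2}, ENNReal.ofReal (‖x‖ ^ 2) ∂ν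
      ≤ ∫⁻ _ in {x | ‖x‖ ≤ 2}, ENNReal.ofReal (2 ^ 2) ∂ν := by
        refine setLIntegral_mono measurable_const fun x hx => ENNReal.ofReal_le_ofReal ?_
        have : ‖x‖ ≤ 2 := hx
        gcongr
    _ < ⊤ := by
        rw [setLIntegral_const]
        exact ENNReal.mul_lt_top ENNReal.ofReal_lt_top (measure_lt_top _ _)

end Mixed

/-! ### The tail function of 1 - X and the laws of X^n. -/

section Tail

variable {Ω : Type*} [MeasurableSpace Ω] {P : Measure Ω}
  {α : ℝ} {ℓ : ℝ → ℝ} {Y : Ω → ℝ}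

theorem BoundedAwayOn.pos {K : Set ℝ} (h : BoundedAwayOn ℓ K) {x : ℝ} (hx : x ∈ K) : 0 < ℓ x := by
  obtain ⟨m, M, hm, hK⟩ := h
  exact hm.trans_le (hK x hx).1

theorem monotone_measureReal_one_sub_lt [IsFiniteMeasure P] :
    Monotone fun x : ℝ => P.real {ω | 1 - x < Y ω} := by
  intro a b hab
  refine measureReal_mono fun ω (hω : 1 - a < Y ω) => ?_
  exact lt_of_le_of_lt (by linarith) hω

theorem measureReal_one_sub_lt_eq
    (htail : ∀ x ∈ Icc (0 : ℝ) 1, P.real {ω | x < Y ω} = (1 - x) ^ α * ℓ (1 - x))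
    {x : ℝ} (hx : x ∈ Ioc (0 : ℝ) 1) : P.real {ω | 1 - x < Y ω} = x ^ α * ℓ x := by
  rw [htail (1 - x) ⟨by linarith [hx.2], by linarith [hx.1]⟩, sub_sub_cancel]

theorem measureReal_one_sub_lt_pos [IsFiniteMeasure P] (hℓ : ∀ x ∈ Ioc (0 : ℝ) 1, 0 < ℓ x)
    (htail : ∀ x ∈ Icc (0 : ℝ) 1, P.real {ω | x < Y ω} = (1 - x) ^ α * ℓ (1 - x))
    {x : ℝ} (hx : 0 < x) : 0 < P.real {ω | 1 - x < Y ω} := by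
  -- The formula x^α ℓ(x) is available only on (0, 1]; monotonicity handles x > 1.
  have hm : min x 1 ∈ Ioc (0 : ℝ) 1 := ⟨lt_min hx one_pos, min_le_right _ _⟩
  refine lt_of_lt_of_le ?_ (monotone_measureReal_one_sub_lt (P := P) (Y := Y) (min_le_left x 1))
  dsimp only
  rw [measureReal_one_sub_lt_eq htail hm]
  exact mul_pos (Real.rpow_pos_of_pos hm.1 _) (hℓ _ hm)

theorem tendsto_measureReal_one_sub_lt_div (hsv : SlowlyVaryingAtZero ℓ)
    (hℓ : ∀ x ∈ Ioc (0 : ℝ) 1, 0 < ℓ x)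
    (htail : ∀ x ∈ Icc (0 : ℝ) 1, P.real {ω | x < Y ω} = (1 - x) ^ α * ℓ (1 - x))
    {t : ℝ} (ht : 0 < t) :
    Tendsto (fun x => P.real {ω | 1 - x * t < Y ω} / P.real {ω | 1 - x < Y ω}) (𝓝[>] 0)
      (𝓝 (t ^ α)) := by
  have h := (hsv t ht).const_mul (t ^ α)
  rw [mul_one] at h
  refine h.congr' ?_
  filter_upwards [Ioo_mem_nhdsGT (show (0 : ℝ) < min 1 t⁻¹ by positivity)] with x hx
  have hx1 : x ∈ Ioc (0 : ℝ) 1 := ⟨hx.1, hx.2.le.trans (min_le_left _ _)⟩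
  have hxt : x * t ∈ Ioc (0 : ℝ) 1 := by
    refine ⟨mul_pos hx.1 ht, ?_⟩
    have := hx.2.le.trans (min_le_right _ _)
    rwa [← one_div, le_div_iff₀ ht] at this
  rw [measureReal_one_sub_lt_eq htail hx1, measureReal_one_sub_lt_eq htail hxt,
    Real.mul_rpow hx.1.le ht.le]
  have := (hℓ x hx1).ne'
  have := (Real.rpow_pos_of_pos hx.1 α).ne'
  field_simp

theorem map_pow_measureReal_Ioi (hYm : Measurable Y) (hY : ∀ᵐ ω ∂P, Y ω ∈ Icc (0 : ℝ) 1)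
    {n : ℕ} (hn : n ≠ 0) {r : ℝ} (hr : 0 < r) :
    (P.map fun ω => Y ω ^ n).real (Ioi r) = P.real {ω | 1 - (1 - r ^ (n : ℝ)⁻¹) < Y ω} := by
  rw [map_measureReal_apply (by fun_prop) measurableSet_Ioi]
  refine measureReal_congr ?_
  filter_upwards [hY] with ω hω
  apply propext
  change r < Y ω ^ n ↔ 1 - (1 - r ^ (n : ℝ)⁻¹) < Y ω
  rw [sub_sub_cancel, Real.rpow_inv_lt_iff_of_pos hr.le hω.1 (by positivity), Real.rpow_natCast]

theorem ae_map_pow_mem_Icc (hYm : Measurable Y) (hY : ∀ᵐ ω ∂P, Y ω ∈ Icc (0 : ℝ) 1) (n : ℕ) :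
    ∀ᵐ x ∂P.map fun ω => Y ω ^ n, x ∈ Icc (0 : ℝ) 1 := by
  refine (ae_map_iff (p := fun x => x ∈ Icc (0 : ℝ) 1) (by fun_prop) measurableSet_Icc).2 ?_
  filter_upwards [hY] with ω hω
  exact ⟨pow_nonneg hω.1 _, pow_le_one₀ hω.1 hω.2⟩

end Tail

/-! ### Characteristic function of the sum, and the conclusion. -/

theorem integrable_id_of_ae_mem_Icc {μ : Measure ℝ} [IsFiniteMeasure μ]
    (h : ∀ᵐ x ∂μ, x ∈ Icc (0 : ℝ) 1) : Integrable (fun x => x) μ := by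
  refine (integrable_const (1 : ℝ)).mono' (by fun_prop) ?_
  filter_upwards [h] with x hx
  rw [Real.norm_of_nonneg hx.1]
  exact hx.2

theorem charFun_map_sum_pow_smul {d : ℕ} {Ω : Type*} [MeasurableSpace Ω] {P : Measure Ω}
    [IsProbabilityMeasure P] {X : ℕ → Ω → ℝ} (hXm : ∀ i, Measurable (X i))
    (hXindep : iIndepFun X P) (hXid : ∀ i, IdentDistrib (X i) (X 0) P P)
    {ν₀ : Measure (EuclideanSpace ℝ (Fin d))} [IsProbabilityMeasure ν₀]
    {T : ℕ → Ω → EuclideanSpace ℝ (Fin d)} (hTm : ∀ i, Measurable (T i))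
    (hTindep : iIndepFun T P) (hTlaw : ∀ i, P.map (T i) = ν₀)
    (hTX : IndepFun (fun ω i => T i ω) (fun ω i => X i ω) P) (n N : ℕ)
    (z : EuclideanSpace ℝ (Fin d)) :
    charFun (P.map fun ω => ∑ i ∈ Finset.range N, X i ω ^ n • T i ω) z =
      (1 + ∫ t, ∫ x, (Complex.exp (Complex.I * ((inner ℝ z t * x : ℝ) : ℂ)) - 1)
        ∂(P.map fun ω => X 0 ω ^ n) ∂ν₀) ^ N := by
  have hX0 : IsProbabilityMeasure (P.map (X 0)) :=
    Measure.isProbabilityMeasure_map (hXm 0).aemeasurable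
  set g : EuclideanSpace ℝ (Fin d) × ℝ → ℂ := fun p =>
    Complex.exp (Complex.I * ((inner ℝ z p.1 * p.2 ^ n : ℝ) : ℂ)) with hg
  have hgc : Continuous g := by fun_prop
  have hgi : Integrable g (ν₀.prod (P.map (X 0))) := by
    refine (integrable_const (1 : ℝ)).mono' hgc.aestronglyMeasurable
      (Eventually.of_forall fun p => ?_)
    rw [hg, Complex.norm_exp_I_mul_ofReal]
  have hsum : Measurable fun ω => ∑ i ∈ Finset.range N, X i ω ^ n • T i ω := by fun_prop
  calc charFun (P.map fun ω => ∑ i ∈ Finset.range N, X i ω ^ n • T i ω) z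
      = ∫ ω, ∏ i ∈ Finset.range N, g (T i ω, X i ω) ∂P := by
        rw [charFun_apply, integral_map hsum.aemeasurable (by fun_prop)]
        congr 1; ext ω
        rw [← Complex.exp_sum, sum_inner]
        congr 1
        push_cast
        rw [Finset.sum_mul]
        refine Finset.sum_congr rfl fun i _ => ?_
        rw [real_inner_smul_left, real_inner_comm]
        push_cast; ring
    _ = (∫ p, g p ∂ν₀.prod (P.map (X 0))) ^ N :=
        integral_prod_range_eq_pow hTm hXm hTindep hXindep hTX hTlaw
          (fun i => (hXid i).map_eq) hgc.measurable N
    _ = _ := by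
        congr 1
        have h1 : ∫ p, (g p - 1) ∂ν₀.prod (P.map (X 0)) = ∫ p, g p ∂ν₀.prod (P.map (X 0)) - 1 := by
          rw [integral_sub hgi (integrable_const _)]; simp
        have h2 : Integrable (fun p => g p - 1) (ν₀.prod (P.map (X 0))) :=
          hgi.sub (integrable_const _)
        rw [← sub_eq_iff_eq_add', ← h1, integral_prod _ h2]
        congr 1; ext t
        have hp : (P.map fun ω => X 0 ω ^ n) = (P.map (X 0)).map (fun x => x ^ n) := by
          rw [Measure.map_map (by fun_prop) (hXm 0)]; rfl
        have hc : Continuous fun x : ℝ =>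
          Complex.exp (Complex.I * ((inner ℝ z t * x : ℝ) : ℂ)) - 1 := by fun_prop
        rw [hp, integral_map (by fun_prop) hc.aestronglyMeasurable]

theorem theorem3 {d : ℕ} {Ω : Type*} [MeasurableSpace Ω] (P : Measure Ω) [IsProbabilityMeasure P]
    (α : ℝ) (hα : 0 < α) (ℓ : ℝ → ℝ) (hℓ : SlowlyVaryingAtZero ℓ)
    (hℓb : ∀ K : Set ℝ, IsCompact K → K ⊆ Ioc 0 1 → BoundedAwayOn ℓ K)
    -- the iid sequence `X i` with values in `[0, 1]`
    (X : ℕ → Ω → ℝ) (hXm : ∀ i, Measurable (X i)) (hXindep : iIndepFun X P)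
    (hXid : ∀ i, IdentDistrib (X i) (X 0) P P)
    (hX01 : ∀ᵐ ω ∂P, X 0 ω ∈ Icc (0 : ℝ) 1)
    (hXtail : ∀ x ∈ Icc (0 : ℝ) 1, P.real {ω | x < X 0 ω} = (1 - x) ^ α * ℓ (1 - x))
    -- the iid sequence `T i` with law `ν₀`, independent of the sequence `X`
    (ν₀ : Measure (EuclideanSpace ℝ (Fin d))) [IsProbabilityMeasure ν₀]
    (T : ℕ → Ω → EuclideanSpace ℝ (Fin d)) (hTm : ∀ i, Measurable (T i))
    (hTindep : iIndepFun T P) (hTlaw : ∀ i, P.map (T i) = ν₀)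
    (hTX : IndepFun (fun ω i => T i ω) (fun ω i => X i ω) P)
    (γ : ℝ) (hγ : γ ∈ Ioo (0 : ℝ) 1) (hTγ : Integrable (fun ω => ‖T 0 ω‖ ^ γ) P)
    (N : ℕ → ℕ) (c : ℝ) (hc : 0 < c)
    (hN : Tendsto (fun n : ℕ => (N n : ℝ) * (n : ℝ) ^ (-α) * ℓ (1 / (n : ℝ))) atTop (𝓝 c)) :
    ∃ μ : ProbabilityMeasure (EuclideanSpace ℝ (Fin d)),
      IsLStar α (ENNReal.ofReal (α * c) • ν₀.restrict {x | 0 < ‖x‖}) 0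
        (μ : Measure (EuclideanSpace ℝ (Fin d))) ∧
      TendstoInDistribution (fun (n : ℕ) ω => ∑ i ∈ Finset.range (N n), (X i ω) ^ n • T i ω)
        atTop id (fun _ => P) (μ : Measure (EuclideanSpace ℝ (Fin d))) := by
  have hγ' : γ ∈ Ioc (0 : ℝ) 1 := Ioo_subset_Ioc_self hγ
  have hℓpos : ∀ x ∈ Ioc (0 : ℝ) 1, 0 < ℓ x := fun x hx =>
    (hℓb {x} isCompact_singleton (singleton_subset_iff.2 hx)).pos rfl
  -- the tail function of `1 - X 0`
  set G : ℝ → ℝ := fun x => P.real {ω | 1 - x < X 0 ω} with hG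
  have hmono : Monotone G := monotone_measureReal_one_sub_lt
  have hpos : ∀ x, 0 < x → 0 < G x := fun x hx => measureReal_one_sub_lt_pos hℓpos hXtail hx
  have hG0 : ∀ x, 0 ≤ G x := fun x => measureReal_nonneg
  have hG1 : ∀ x, G x ≤ 1 := fun x => measureReal_le_one
  have hreg : ∀ t, 0 < t → Tendsto (fun x => G (x * t) / G x) (𝓝[>] 0) (𝓝 (t ^ α)) :=
    fun t ht => tendsto_measureReal_one_sub_lt_div hℓ hℓpos hXtail ht
  have hNG : Tendsto (fun n : ℕ => N n * G (n : ℝ)⁻¹) atTop (𝓝 c) := by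
    refine hN.congr' ?_
    filter_upwards [eventually_gt_atTop 0] with n hn
    have hn1 : (n : ℝ)⁻¹ ∈ Ioc (0 : ℝ) 1 :=
      ⟨by positivity, inv_le_one_of_one_le₀ (by exact_mod_cast hn)⟩
    rw [hG]
    dsimp only
    rw [measureReal_one_sub_lt_eq hXtail hn1, one_div, Real.rpow_neg (by positivity),
      Real.inv_rpow (by positivity), mul_assoc]
  have hNtop : Tendsto N atTop atTop :=
    tendsto_atTop_of_tendsto_mul_regularlyVarying hα hc hmono hpos hreg hNG
  -- the normalized laws of `X 0 ^ n` and their limit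
  set lam : ℕ → Measure ℝ := fun n => (N n : NNReal) • P.map fun ω => X 0 ω ^ n with hlam
  have hαc : 0 < α * c := mul_pos hα hc
  -- The factor α cancels the 1/α in the tail of `logPowerMeasure α`, leaving c (-log r)^α.
  set lam₀ : Measure ℝ := (α * c).toNNReal • logPowerMeasure α with hlam₀
  have hfin : ∀ n, IsFiniteMeasure (lam n) := fun n => by
    have := Measure.isProbabilityMeasure_map (μ := P) (f := fun ω => X 0 ω ^ n)
      ((hXm 0).pow_const n).aemeasurable
    infer_instance
  have h01 : ∀ n, ∀ᵐ x ∂lam n, x ∈ Icc (0 : ℝ) 1 := fun n =>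
    Measure.ae_smul_measure (ae_map_pow_mem_Icc (hXm 0) hX01 n) _
  have h01' : ∀ᵐ x ∂lam₀, x ∈ Icc (0 : ℝ) 1 := Measure.ae_smul_measure
    ((ae_mem_Ioo_logPowerMeasure α).mono fun r hr => Ioo_subset_Icc_self hr) _
  have hmom₀ : ∫⁻ x, ENNReal.ofReal (x ^ γ) ∂lam₀ < ⊤ := by
    rw [hlam₀, lintegral_smul_measure]
    exact ENNReal.mul_lt_top ENNReal.coe_lt_top (lintegral_rpow_logPowerMeasure_lt_top hα hγ.1)
  have hreal : ∀ n : ℕ, n ≠ 0 → ∀ r ∈ Ioo (0 : ℝ) 1,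
      (lam n).real (Ioi r) = N n * G (1 - r ^ (n : ℝ)⁻¹) := by
    intro n hn r hr
    rw [hlam]
    dsimp only
    rw [measureReal_nnreal_smul_apply, map_pow_measureReal_Ioi (hXm 0) hX01 hn hr.1]
    simp [hG]
  -- Exponent γ/2 serves twice: below γ for the moment bound, below 1 for dominated convergence.
  obtain ⟨C, hC, hdom⟩ := exists_natCast_mul_one_sub_rpow_inv_le hmono hpos hG0 hG1 hreg hNG
    (half_pos hγ.1)
  have hdom' : ∀ᶠ n in atTop, ∀ r ∈ Ioo (0 : ℝ) 1,
      (lam n).real (Ioi r) ≤ C * r ^ (-(γ / 2)) := by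
    filter_upwards [hdom, eventually_ne_atTop 0] with n hn hn0 r hr
    rw [hreal n hn0 r hr]
    exact hn r hr
  have hmom : ∀ᶠ n in atTop, ∫⁻ x, ENNReal.ofReal (x ^ γ) ∂lam n ≤ ENNReal.ofReal (2 * C) := by
    filter_upwards [hdom'] with n hn
    refine lintegral_rpow_le_of_measure_Ioi_le hγ.1 hC.le (h01 n) fun r hr => ?_
    rw [← ofReal_measureReal]
    exact ENNReal.ofReal_le_ofReal (hn r hr)
  have htail : ∀ r ∈ Ioo (0 : ℝ) 1,
      Tendsto (fun n => (lam n).real (Ioi r)) atTop (𝓝 (lam₀.real (Ioi r))) := by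
    intro r hr
    have hL : 0 < -Real.log r := neg_pos.2 (Real.log_neg hr.1 hr.2)
    have h1 : lam₀.real (Ioi r) = c * (-Real.log r) ^ α := by
      rw [hlam₀, measureReal_nnreal_smul_apply, Measure.real, logPowerMeasure_Ioi hα hr,
        ENNReal.toReal_ofReal (by positivity), Real.coe_toNNReal _ hαc.le]
      field_simp
    rw [h1]
    refine (tendsto_natCast_mul_one_sub_rpow_inv hmono hpos hreg hNG hr).congr' ?_
    filter_upwards [eventually_ne_atTop 0] with n hn
    rw [hreal n hn r hr]
  have hlim := tendsto_integral_exp_I_mul_sub_one h01 h01'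
    (fun n => integrable_id_of_ae_mem_Icc (h01 n))
    (integrable_id_of_lintegral_rpow_lt_top hγ' h01' hmom₀) (by linarith [hγ.2]) hdom' htail
  -- the moments of `ν₀`
  have hν₀ : Integrable (fun t => ‖t‖ ^ γ) ν₀ := by
    rw [← hTlaw 0]
    exact (integrable_map_measure (measurable_norm.pow_const γ).aestronglyMeasurable
      (hTm 0).aemeasurable).2 hTγ
  have hν₀' : ∫⁻ t, ENNReal.ofReal (‖t‖ ^ γ) ∂ν₀ < ⊤ := by
    have := hν₀.2
    rwa [hasFiniteIntegral_iff_ofReal (Eventually.of_forall fun x => by positivity)] at this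
  set Φ : EuclideanSpace ℝ (Fin d) → ℂ := fun z =>
    ∫ t, ∫ x, (Complex.exp (Complex.I * ((inner ℝ z t * x : ℝ) : ℂ)) - 1) ∂lam₀ ∂ν₀ with hΦ
  have hΦlim : ∀ z, Tendsto (fun n => ∫ t, ∫ x,
      (Complex.exp (Complex.I * ((inner ℝ z t * x : ℝ) : ℂ)) - 1) ∂lam n ∂ν₀) atTop (𝓝 (Φ z)) :=
    tendsto_integral_integral_exp_inner_sub_one hγ' hν₀ h01 (by positivity) hmom hlim
  have hΦ0 : Φ 0 = 0 := by simp [hΦ]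
  have hΦc : ContinuousAt Φ 0 := by
    rw [ContinuousAt, hΦ0]
    exact tendsto_integral_integral_exp_inner_sub_one_zero hγ' hν₀ h01' hmom₀
  -- convergence of the characteristic functions
  set A : ℕ → Ω → EuclideanSpace ℝ (Fin d) := fun n ω =>
    ∑ i ∈ Finset.range (N n), (X i ω) ^ n • T i ω with hA
  have hAm : ∀ n, Measurable (A n) := fun n => by fun_prop
  have hchar : ∀ z, Tendsto (fun n => charFun (P.map (A n)) z) atTop (𝓝 (Complex.exp (Φ z))) := by
    intro z
    simp_rw [hA, charFun_map_sum_pow_smul hXm hXindep hXid hTm hTindep hTlaw hTX]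
    refine tendsto_one_add_pow_exp_of_tendsto_mul hNtop ((hΦlim z).congr fun n => ?_)
    rw [← integral_const_mul]
    congr 1; ext t
    rw [hlam]
    dsimp only
    rw [integral_smul_nnreal_measure, NNReal.smul_def, Complex.real_smul]
    simp
  obtain ⟨μ, hμlim, hμchar⟩ := exists_probabilityMeasure_of_tendsto_charFun
    (μ := fun n => ⟨P.map (A n), Measure.isProbabilityMeasure_map (hAm n).aemeasurable⟩)
    (Complex.continuous_exp.continuousAt.comp hΦc) hchar
  refine ⟨μ, ?_, ?_⟩
  · set ν : Measure (EuclideanSpace ℝ (Fin d)) :=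
      ENNReal.ofReal (α * c) • ν₀.restrict {x | 0 < ‖x‖} with hν
    have hνfin : IsFiniteMeasure ν := Measure.smul_finite _ ENNReal.ofReal_ne_top
    have hν0 : ν {0} = 0 := by
      rw [hν, Measure.smul_apply, Measure.restrict_apply (measurableSet_singleton 0)]
      have : ({0} : Set (EuclideanSpace ℝ (Fin d))) ∩ {x | 0 < ‖x‖} = ∅ := by
        ext x; simp
      rw [this, measure_empty, smul_zero]
    have hνγ : ∫⁻ t, ENNReal.ofReal (‖t‖ ^ γ) ∂ν < ⊤ := by
      rw [hν, lintegral_smul_measure]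
      exact ENNReal.mul_lt_top ENNReal.ofReal_lt_top
        ((setLIntegral_le_lintegral _ _).trans_lt hν₀')
    refine ⟨hνfin, hν0, ENNReal.add_lt_top.2 ⟨lintegral_norm_sq_lt_top,
      lintegral_log_rpow_lt_top hα hγ.1 hνγ⟩, inferInstance, mixedMeasure_singleton_zero hν0,
      lintegral_min_mixedMeasure_lt_top hα hγ' hνγ, fun z => ?_⟩
    rw [hμchar, integral_mixedMeasure_exp_sub_one hα hγ' hνγ]
    simp only [inner_zero_left, Complex.ofReal_zero, mul_zero, zero_add, Function.comp]
    congr 1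
    -- Discarding the atom of ν₀ at 0 changes nothing, since the integrand vanishes at t = 0.
    rw [hν, integral_smul_measure, setIntegral_eq_integral_of_forall_compl_eq_zero,
      ENNReal.toReal_ofReal hαc.le, ← integral_smul]
    · refine integral_congr_ae (Eventually.of_forall fun t => ?_)
      dsimp only
      rw [hlam₀, integral_smul_nnreal_measure, NNReal.smul_def, Real.coe_toNNReal _ hαc.le]
    · intro t ht
      have : t = 0 := by simpa using ht
      simp [this]
  · refine ⟨fun n => (hAm n).aemeasurable, aemeasurable_id, ?_⟩
    have hid : (⟨(μ : Measure (EuclideanSpace ℝ (Fin d))).map id,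
        Measure.isProbabilityMeasure_map aemeasurable_id⟩ :
        ProbabilityMeasure (EuclideanSpace ℝ (Fin d))) = μ := Subtype.ext Measure.map_id
    rw [hid]
    exact hμlim
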